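/- Let $d\ge 1$. A state is a unit vector $|\psi\rangle\in\mathbb C^d$; $|\psi^*\rangle$ denotes its entrywise complex conjugate in the computational basis $|0\rangle,\dots,|d-1\rangle$. Let $\mathbb S_t$ act on $(\mathbb C^d)^{\otimes t}$ by $\sigma(\psi_1\otimes\dots\otimes\psi_t)=\psi_{\sigma^{-1}(1)}\otimes\dots\otimes\psi_{\sigma^{-1}(t)}$, and put $$\rho_{sym}^{(t)}=\frac{1}{\prod_{j=0}^{t-1}(d+j)}\sum_{\sigma\in\mathbb S_t}\sigma .$$ A probability measure $\eta$ on the unit sphere of $\mathbb C^d$ is an exact state $t$-design if $\int |\varphi\rangle\langle\varphi|^{\otimes t}\,d\eta(\varphi)=\int_{\mathbb U(d)}(U|0\rangle\langle 0|U^\dagger)^{\otimes t}\,dU$. Here $dU$ and $dO$ are the Haar probability measures on the unitary group $\mathbb U(d)$ and the orthogonal group $\mathbb O(d)$ of real orthogonal matrices. The orbit of $|\psi\rangle$ is the distribution of $O|\psi\rangle$ for $O$ Haar distributed on $\mathbb O(d)$. 1. There is a state $|\psi\rangle\in\mathbb C^d$ with $|\langle\psi^*|\psi\rangle|^2=\frac{2}{d+1}$.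 For every such state, $\int_{\mathbb O(d)}(O|\psi\rangle\langle\psi|O^{T})^{\otimes 3}\,dO=\rho_{sym}^{(3)}$, and the orbit of $|\psi\rangle$ is an exact state $3$-design. 2. If $d>1$ and $t>3$, then for every state $|\psi\rangle\in\mathbb C^d$ we have $\int_{\mathbb O(d)}(O|\psi\rangle\langle\psi|O^{T})^{\otimes t}\,dO\neq\rho_{sym}^{(t)}$, and the orbit of $|\psi\rangle$ is not an exact state $t$-design. 3. If a state $|\psi\rangle\in\mathbb C^d$ satisfies $\int_{\mathbb O(d)}(O|\psi\rangle\langle\psi|O^{T})^{\otimes 4}\,dO=\rho_{sym}^{(4)}$, then $|\langle\psi^*|\psi\rangle|^2=\frac{2}{d+1}$ and $|\langle\psi^*|\psi\rangle|^4=\frac{8}{(d+1)(d+3)}$. For $d>1$ no real number $x$ satisfies both $x^2=\frac{2}{d+1}$ and $x^4=\frac{8}{(d+1)(d+3)}$. -/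

import Mathlib

open MeasureTheory

/-! ### The unitary and the orthogonal group and their Haar probability measures

`Matrix.unitaryGroup (Fin d) ℂ` is the unitary group `U(d)`, and `Matrix.unitaryGroup (Fin d) ℝ`
is the orthogonal group `O(d)`, since `star` is the transpose for real matrices. -/

namespace OrthDesign

/-- The orthogonal group `O(d)` (see `mem_orthGroup_iff`). -/
abbrev OrthGroup (d : ℕ) := Matrix.unitaryGroup (Fin d) ℝ

/-- The unitary group `U(d)`. -/
abbrev UnitGroup (d : ℕ) := Matrix.unitaryGroup (Fin d) ℂ

theorem mem_orthGroup_iff {d : ℕ} {A : Matrix (Fin d) (Fin d) ℝ} :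
    A ∈ OrthGroup d ↔ A * A.transpose = 1 := by
  rw [Matrix.mem_unitaryGroup_iff, Matrix.star_eq_conjTranspose,
    Matrix.conjTranspose_eq_transpose_of_trivial]

instance compactSpace_unitaryGroup (𝕜 : Type) [RCLike 𝕜] (d : ℕ) :
    CompactSpace (Matrix.unitaryGroup (Fin d) 𝕜) := by
  refine isCompact_iff_compactSpace.mp ?_
  have hK : IsCompact (Set.pi Set.univ fun _ : Fin d =>
      Set.pi Set.univ fun _ : Fin d => Metric.closedBall (0 : 𝕜) 1) :=
    isCompact_univ_pi fun _ => isCompact_univ_pi fun _ => isCompact_closedBall _ _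
  refine hK.of_isClosed_subset (isClosed_unitary (R := Matrix (Fin d) (Fin d) 𝕜)) ?_
  intro U hU i _ j _
  simpa using entry_norm_bound_of_unitary hU i j

instance measurableSpace_unitaryGroup (𝕜 : Type) [RCLike 𝕜] (d : ℕ) :
    MeasurableSpace (Matrix.unitaryGroup (Fin d) 𝕜) := borel _

instance borelSpace_unitaryGroup (𝕜 : Type) [RCLike 𝕜] (d : ℕ) :
    BorelSpace (Matrix.unitaryGroup (Fin d) 𝕜) := ⟨rfl⟩

/-- The Haar measure of a compact group, normalized to total mass one. -/
noncomputable def haarProb (G : Type) [Group G] [TopologicalSpace G] [IsTopologicalGroup G]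
    [CompactSpace G] [MeasurableSpace G] [BorelSpace G] : Measure G :=
  Measure.haarMeasure (⊤ : TopologicalSpace.PositiveCompacts G)

/-! ### States, tensor powers and moment operators

Operators on `(ℂ^d)^{⊗ t}` are written as matrices in the computational basis, which is
indexed by the words `i : Fin t → Fin d`. -/

/-- The rank-one operator `|ψ⟩⟨ψ|`. -/
noncomputable def ketBra {d : ℕ} (ψ : EuclideanSpace ℂ (Fin d)) : Matrix (Fin d) (Fin d) ℂ :=
  Matrix.of fun a b => ψ a * star (ψ b)

/-- The tensor power `A^{⊗ t}` of an operator `A` on `ℂ^d`. -/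
def tensorPow {d : ℕ} (t : ℕ) (A : Matrix (Fin d) (Fin d) ℂ) :
    Matrix (Fin t → Fin d) (Fin t → Fin d) ℂ :=
  Matrix.of fun i j => ∏ k, A (i k) (j k)

/-- A real orthogonal matrix, regarded as a complex matrix. -/
noncomputable def orthToComplex {d : ℕ} (O : OrthGroup d) : Matrix (Fin d) (Fin d) ℂ :=
  (O : Matrix (Fin d) (Fin d) ℝ).map Complex.ofReal

/-- The twirl `∫_{O(d)} (O |ψ⟩⟨ψ| Oᵀ)^{⊗ t} dO`; the integral is taken entry by entry. -/
noncomputable def orthTwirl {d : ℕ} (t : ℕ) (ψ : EuclideanSpace ℂ (Fin d)) :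
    Matrix (Fin t → Fin d) (Fin t → Fin d) ℂ :=
  Matrix.of fun i j => ∫ O : OrthGroup d,
    tensorPow t (orthToComplex O * ketBra ψ * (orthToComplex O).transpose) i j
      ∂(haarProb (OrthGroup d))

/-- The twirl `∫_{U(d)} (U |ψ⟩⟨ψ| U†)^{⊗ t} dU`. -/
noncomputable def unitTwirl {d : ℕ} (t : ℕ) (ψ : EuclideanSpace ℂ (Fin d)) :
    Matrix (Fin t → Fin d) (Fin t → Fin d) ℂ :=
  Matrix.of fun i j => ∫ U : UnitGroup d,
    tensorPow t ((U : Matrix (Fin d) (Fin d) ℂ) * ketBra ψ *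
      (U : Matrix (Fin d) (Fin d) ℂ).conjTranspose) i j ∂(haarProb (UnitGroup d))

/-- The operator `σ (ψ_1 ⊗ ⋯ ⊗ ψ_t) = ψ_{σ⁻¹(1)} ⊗ ⋯ ⊗ ψ_{σ⁻¹(t)}`: it sends the basis vector of
the word `j` to the basis vector of the word `j ∘ σ⁻¹`. -/
def permOp (d : ℕ) {t : ℕ} (σ : Equiv.Perm (Fin t)) :
    Matrix (Fin t → Fin d) (Fin t → Fin d) ℂ :=
  Matrix.of fun i j => if i = fun k => j (σ⁻¹ k) then 1 else 0

/-- `ρ_sym = (1 / (d (d + 1) ⋯ (d + t - 1))) ∑_{σ ∈ S_t} σ`, the normalized projector onto the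
symmetric subspace of `(ℂ^d)^{⊗ t}`. -/
noncomputable def rhoSym (d t : ℕ) : Matrix (Fin t → Fin d) (Fin t → Fin d) ℂ :=
  (1 / ∏ j ∈ Finset.range t, ((d : ℂ) + (j : ℂ))) • ∑ σ : Equiv.Perm (Fin t), permOp d σ

/-- The `t`-th moment operator `∫ |φ⟩⟨φ|^{⊗ t} dη(φ)`. -/
noncomputable def momentOp {d : ℕ} (t : ℕ) (η : Measure (EuclideanSpace ℂ (Fin d))) :
    Matrix (Fin t → Fin d) (Fin t → Fin d) ℂ :=
  Matrix.of fun i j => ∫ φ, tensorPow t (ketBra φ) i j ∂η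

/-- An exact state `t`-design: a probability measure on the unit sphere of `ℂ^d` whose `t`-th
moment operator is that of the Haar random state `U |0⟩`. -/
def IsStateDesign {d : ℕ} [NeZero d] (t : ℕ) (η : Measure (EuclideanSpace ℂ (Fin d))) : Prop :=
  IsProbabilityMeasure η ∧ (∀ᵐ φ ∂η, ‖φ‖ = 1) ∧
    momentOp t η = unitTwirl t (EuclideanSpace.single (0 : Fin d) (1 : ℂ))

/-- The distribution of the random state `O |ψ⟩`, where `O` is Haar distributed on `O(d)`. -/
noncomputable def orbitLaw {d : ℕ} (ψ : EuclideanSpace ℂ (Fin d)) :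
    Measure (EuclideanSpace ℂ (Fin d)) :=
  Measure.map (fun O : OrthGroup d => WithLp.toLp 2 ((orthToComplex O).mulVec ψ.ofLp))
    (haarProb (OrthGroup d))

/-- The entrywise complex conjugate `|ψ*⟩`. -/
noncomputable def conjVec {d : ℕ} (ψ : EuclideanSpace ℂ (Fin d)) : EuclideanSpace ℂ (Fin d) :=
  WithLp.toLp 2 fun a => star (ψ a)

/-- `|⟨ψ*|ψ⟩|`. -/
noncomputable def overlap {d : ℕ} (ψ : EuclideanSpace ℂ (Fin d)) : ℝ :=
  ‖inner ℂ (conjVec ψ) ψ‖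

end OrthDesign

/-!
The entries of the twirl over `O(d)` are moments of the random vector `Z = O ψ` and of its conjugate
`W`. Two contractions are constant along the orbit: `∑ Z_a W_a = 1`, and `∑ Z_a ^ 2 = σ` with
`|σ|` the overlap.

*Reduction to two coordinates.* By polarization (`moment_eq_of_linForm`, from Ryser's formula for
the permanent) the twirl equals `rhoSym` once `E[(u · Z)^t (w · W)^t] = C (u · w)^t` for all real
vectors `u`, `w`; the constant `C` comes for free from the trace (`moment_eq_rhoSym`). Orthogonal
invariance moves `u`, `w` into the span of `e_p`, `e_q` with `u` parallel to `e_p`, so it is enough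
that the mixed moments `E[Z_p^t W_p^k W_q^(t-k)]` with `k < t` vanish
(`IsOrthInvariant.moment_linForm_linForm`). For a Haar random state of `U(d)` they vanish by phase
invariance, for every `t` (`unitTwirl_eq_rhoSym`); hence being a state design is the same as having
twirl `rhoSym`.

*The case `t = 3`.* Reflections kill the mixed moments except `E[Z_p^3 W_p W_q^2]`. The moments
in a single coordinate are functions of `σ`, obtained by averaging over the vectors `e_p ± e_q`
(`IsOrthInvariant.sum_add_sub`), and contracting `∑ W_q^2` expresses the remaining mixed moment
through them; for `|σ|^2 = 2 / (d + 1)` it is zero (`IsOrthInvariant.mixed_moment_eq_zero`).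

*The case `t > 3`.* Partial traces reduce to `t = 4` and `t = 2`
(`orthTwirl_eq_rhoSym_of_le`). There `conj σ E[Z_0^2]` and `conj σ ^ 2 E[Z_0^4]` can be computed from
`rhoSym` and from orthogonal invariance, which gives `|σ|^2 = 2 / (d + 1)` and
`|σ|^4 = 8 / ((d + 1) (d + 3))`; these are incompatible for `d > 1`.
-/

namespace OrthDesign

/-! ### Ryser's formula and the matrix entries of `rhoSym` -/

/-- Ryser's formula for the permanent. -/
theorem ryser_permanent {n R : Type*} [Fintype n] [DecidableEq n] [CommRing R] (A : n → n → R) :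
    ∑ T : Finset n, (-1) ^ (Tᶜ).card * ∏ k, ∑ l ∈ T, A k l =
      ∑ σ : Equiv.Perm n, ∏ k, A k (σ k) := by
  have hexp : ∀ T : Finset n, (-1 : R) ^ (Tᶜ).card * ∏ k, ∑ l ∈ T, A k l =
      ∑ f : n → n, (if Tᶜ ⊆ (Finset.univ.image f)ᶜ then (-1 : R) ^ (Tᶜ).card else 0) *
        ∏ k, A k (f k) := by
    intro T
    have : ∀ k, ∑ l ∈ T, A k l = ∑ l, if l ∈ T then A k l else 0 := by
      intro k; simp
    simp_rw [this]
    rw [Fintype.prod_sum, Finset.mul_sum]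
    refine Finset.sum_congr rfl fun f _ => ?_
    by_cases hf : ∀ k, f k ∈ T
    · rw [if_pos, Finset.prod_congr rfl fun k _ => if_pos (hf k)]
      rw [Finset.compl_subset_compl]
      simpa [Finset.subset_iff] using hf
    · rw [if_neg, zero_mul]
      · push Not at hf
        obtain ⟨k, hk⟩ := hf
        rw [Finset.prod_eq_zero (Finset.mem_univ k) (if_neg hk), mul_zero]
      · rw [Finset.compl_subset_compl]
        simpa [Finset.subset_iff] using hf
  simp_rw [hexp]
  rw [Finset.sum_comm]
  -- inclusion-exclusion: only the surjective maps survive the sum over `T`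
  have hsum : ∀ f : n → n,
      ∑ T : Finset n, (if Tᶜ ⊆ (Finset.univ.image f)ᶜ then (-1 : R) ^ (Tᶜ).card else 0) =
        if (Finset.univ.image f)ᶜ = ∅ then 1 else 0 := by
    intro f
    rw [Function.Bijective.sum_comp (compl_bijective (α := Finset n))
      (fun S => if S ⊆ (Finset.univ.image f)ᶜ then (-1 : R) ^ S.card else 0)]
    rw [← Finset.sum_filter]
    have hp : Finset.univ.filter (fun S : Finset n => S ⊆ (Finset.univ.image f)ᶜ) =
        ((Finset.univ.image f)ᶜ).powerset := by
      ext S; simp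
    rw [hp]
    have := congrArg (Int.cast : ℤ → R)
      (Finset.sum_powerset_neg_one_pow_card (x := (Finset.univ.image f)ᶜ))
    push_cast at this
    exact this
  simp_rw [← Finset.sum_mul, hsum]
  symm
  refine Fintype.sum_of_injective (fun σ : Equiv.Perm n => (σ : n → n))
    DFunLike.coe_injective _ _ ?_ ?_
  · intro f hf
    rw [if_neg, zero_mul]
    intro h
    apply hf
    have hs : Function.Surjective f := by
      intro y
      have hy : y ∈ Finset.univ.image f := by
        rw [(Finset.compl_eq_empty_iff _).mp h]
        exact Finset.mem_univ y
      simpa using hy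
    exact ⟨Equiv.ofBijective f (Finite.surjective_iff_bijective.mp hs), rfl⟩
  · intro σ
    rw [if_pos, one_mul]
    rw [Finset.compl_eq_empty_iff]
    exact Finset.image_univ_of_surjective σ.surjective

/-- The number of permutations that carry the word `j` to the word `i`. -/
def permCount {d t : ℕ} (i j : Fin t → Fin d) : ℂ :=
  ∑ σ : Equiv.Perm (Fin t), ∏ k, if i k = j (σ k) then 1 else 0

theorem rhoSym_apply (d t : ℕ) (i j : Fin t → Fin d) :
    rhoSym d t i j = (1 / ∏ k ∈ Finset.range t, ((d : ℂ) + (k : ℂ))) * permCount i j := by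
  simp only [rhoSym, permOp, permCount, Matrix.smul_apply, Matrix.sum_apply, Matrix.of_apply,
    smul_eq_mul]
  congr 1
  rw [← Equiv.sum_comp (Equiv.inv (Equiv.Perm (Fin t)))]
  refine Finset.sum_congr rfl fun σ _ => ?_
  simp only [Equiv.inv_apply, inv_inv]
  rw [Finset.prod_ite_zero]
  simp [funext_iff]

/-- Contracting the first letter: every `τ ∈ S_t` extends to `S_{t+1}` either by a loop, which
leaves `d` choices of the letter, or in `t` ways that determine the letter. -/
theorem sum_permCount_cons {d t : ℕ} (i j : Fin t → Fin d) :
    ∑ c, permCount (Fin.cons c i : Fin (t + 1) → Fin d) (Fin.cons c j) =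
      ((d : ℂ) + t) * permCount i j := by
  simp only [permCount]
  rw [Finset.sum_comm]
  rw [← Equiv.sum_comp Equiv.Perm.decomposeFin.symm, Fintype.sum_prod_type, Finset.sum_comm,
    Finset.mul_sum]
  refine Finset.sum_congr rfl fun τ _ => ?_
  simp only [Fin.prod_univ_succ, Equiv.Perm.decomposeFin_symm_apply_zero,
    Equiv.Perm.decomposeFin_symm_apply_succ, Fin.cons_zero, Fin.cons_succ]
  rw [Fin.sum_univ_succ]
  simp only [Fin.cons_zero, if_true, Equiv.swap_self, Equiv.refl_apply, Fin.cons_succ, one_mul,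
    Finset.sum_const, Finset.card_univ, Fintype.card_fin, nsmul_eq_mul, add_mul]
  congr 1
  have : ∀ p : Fin t, ∑ c : Fin d, ((if c = j p then (1 : ℂ) else 0) *
      ∏ k, if i k = (Fin.cons c j : Fin (t + 1) → Fin d) (Equiv.swap 0 p.succ (τ k).succ)
        then 1 else 0) = ∏ k, if i k = j (τ k) then 1 else 0 := by
    intro p
    rw [Finset.sum_eq_single (j p) (fun c _ hc => by rw [if_neg hc, zero_mul])
      (fun h => absurd (Finset.mem_univ _) h), if_pos rfl, one_mul]
    refine Finset.prod_congr rfl fun k _ => ?_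
    by_cases hk : τ k = p
    · simp [hk]
    · rw [Equiv.swap_apply_of_ne_of_ne (Fin.succ_ne_zero _)
        (fun h => hk (Fin.succ_injective _ h)), Fin.cons_succ]
  simp only [this, Finset.sum_const, Finset.card_univ, Fintype.card_fin, nsmul_eq_mul]

theorem sum_permCount_self (d t : ℕ) :
    ∑ i : Fin t → Fin d, permCount i i = ∏ k ∈ Finset.range t, ((d : ℂ) + (k : ℂ)) := by
  induction t with
  | zero => simp [permCount]
  | succ t ih =>
    rw [← (Fin.consEquiv fun _ => Fin d).sum_comp, Fintype.sum_prod_type, Finset.sum_comm,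
      Finset.prod_range_succ, ← ih, Finset.sum_mul]
    refine Finset.sum_congr rfl fun i _ => ?_
    simpa [Fin.consEquiv, mul_comm] using sum_permCount_cons i i

theorem permCount_const {d t : ℕ} (p : Fin d) (j : Fin t → Fin d) :
    permCount (fun _ => p) j = if ∀ k, j k = p then (t.factorial : ℂ) else 0 := by
  have : ∀ σ : Equiv.Perm (Fin t), (∏ k, if p = j (σ k) then (1 : ℂ) else 0) =
      if ∀ k, j k = p then 1 else 0 := by
    intro σ
    rw [Equiv.prod_comp σ (fun k => if p = j k then (1 : ℂ) else 0), Finset.prod_ite_zero]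
    simp [eq_comm]
  simp only [permCount, this, Finset.sum_const, Finset.card_univ, Fintype.card_perm,
    Fintype.card_fin, nsmul_eq_mul, mul_ite, mul_one, mul_zero]

theorem prod_add_ne_zero {d : ℕ} [NeZero d] (t : ℕ) :
    ∏ k ∈ Finset.range t, ((d : ℂ) + (k : ℂ)) ≠ 0 := by
  refine Finset.prod_ne_zero_iff.mpr fun k _ => ?_
  have := NeZero.ne d
  exact_mod_cast (by omega : d + k ≠ 0)

theorem sum_rhoSym_cons {d : ℕ} [NeZero d] (t : ℕ) (i j : Fin t → Fin d) :
    ∑ c, rhoSym d (t + 1) (Fin.cons c i) (Fin.cons c j) = rhoSym d t i j := by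
  simp only [rhoSym_apply, ← Finset.mul_sum, sum_permCount_cons]
  have h := prod_add_ne_zero (d := d) (t + 1)
  rw [Finset.prod_range_succ] at h ⊢
  obtain ⟨h1, h2⟩ := mul_ne_zero_iff.mp h
  field_simp

/-! ### Moment functionals -/

section Algebra

variable {A : Type*} [CommRing A] [Algebra ℂ A] {d : ℕ}

/-- The linear form with the real coefficient vector `u`, evaluated at the tuple `Z`. -/
noncomputable def linForm (Z : Fin d → A) (u : Fin d → ℝ) : A := ∑ a, (u a : ℂ) • Z a

theorem linForm_sum_single {ι : Type*} (Z : Fin d → A) (i : ι → Fin d) (S : Finset ι) :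
    linForm Z (∑ k ∈ S, Pi.single (i k) 1) = ∑ k ∈ S, Z (i k) := by
  simp only [linForm, Finset.sum_apply, Complex.ofReal_sum, Finset.sum_smul]
  rw [Finset.sum_comm]
  refine Finset.sum_congr rfl fun k _ => ?_
  rw [Finset.sum_eq_single (i k)] <;> simp +contextual

/-- Ryser's formula for a matrix with equal rows. -/
theorem factorial_mul_prod {t : ℕ} {R : Type*} [CommRing R] (x : Fin t → R) :
    (t.factorial : R) * ∏ k, x k =
      ∑ S : Finset (Fin t), (-1) ^ (Sᶜ).card * (∑ k ∈ S, x k) ^ t := by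
  have := ryser_permanent (fun _ l : Fin t => x l)
  simp only [Finset.prod_const, Finset.card_univ, Fintype.card_fin] at this
  rw [this]
  simp [Equiv.prod_comp, Fintype.card_perm]

/-- Polarization: the values of a moment on powers of real linear forms determine its values on
words. Applying Ryser's formula in both groups of variables turns the scalar kernel
`(u ⬝ᵥ w) ^ t` into the permanent that counts permutations. -/
theorem moment_eq_of_linForm (E : A →ₗ[ℂ] ℂ) (Z W : Fin d → A) (t : ℕ) (C : ℂ)
    (h : ∀ u w : Fin d → ℝ,
      E (linForm Z u ^ t * linForm W w ^ t) = C * ((u ⬝ᵥ w : ℝ) : ℂ) ^ t)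
    (i j : Fin t → Fin d) :
    E ((∏ k, Z (i k)) * ∏ k, W (j k)) = C / t.factorial * permCount i j := by
  have ht : (t.factorial : ℂ) ≠ 0 := by exact_mod_cast t.factorial_ne_zero
  have hdot : ∀ S T : Finset (Fin t),
      (((∑ k ∈ S, Pi.single (i k) 1 : Fin d → ℝ) ⬝ᵥ (∑ l ∈ T, Pi.single (j l) 1 : Fin d → ℝ)
        : ℝ) : ℂ) = ∑ k ∈ S, ∑ l ∈ T, if i k = j l then 1 else 0 := by
    intro S T
    simp only [dotProduct, Finset.sum_apply, Finset.sum_mul_sum]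
    rw [Finset.sum_comm]
    push_cast
    refine Finset.sum_congr rfl fun k _ => ?_
    rw [Finset.sum_comm]
    refine Finset.sum_congr rfl fun l _ => ?_
    rw [Finset.sum_eq_single (i k)] <;> simp +contextual [Pi.single_apply, apply_ite]
  have hST : ∀ S T : Finset (Fin t), E ((∑ k ∈ S, Z (i k)) ^ t * (∑ l ∈ T, W (j l)) ^ t) =
      C * (∑ k ∈ S, ∑ l ∈ T, if i k = j l then 1 else 0) ^ t := by
    intro S T
    rw [← linForm_sum_single, ← linForm_sum_single, h, hdot]
  have hsgn : ∀ (n : ℕ) (x : A), E ((-1) ^ n * x) = (-1) ^ n * E x := by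
    intro n x
    rcases Nat.even_or_odd n with h3 | h3 <;> simp [h3.neg_one_pow]
  have key : (t.factorial : ℂ) * (t.factorial * E ((∏ k, Z (i k)) * ∏ k, W (j k))) =
      C * (t.factorial * permCount i j) := by
    have h1 : (t.factorial : ℂ) * (t.factorial * E ((∏ k, Z (i k)) * ∏ k, W (j k))) =
        E (((t.factorial : A) * ∏ k, Z (i k)) * ((t.factorial : A) * ∏ k, W (j k))) := by
      rw [mul_mul_mul_comm, ← Nat.cast_mul, ← nsmul_eq_mul (_ * _), map_nsmul, nsmul_eq_mul,
        Nat.cast_mul, mul_assoc]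
    rw [h1, factorial_mul_prod, factorial_mul_prod, Finset.sum_mul_sum]
    simp only [map_sum, mul_mul_mul_comm ((-1 : A) ^ _), ← pow_add, hsgn, hST]
    simp only [pow_add]
    -- resum over `S`, and then over `T`
    have h2 : ∀ T : Finset (Fin t), ∑ S : Finset (Fin t), (-1 : ℂ) ^ (Sᶜ).card *
        (∑ k ∈ S, ∑ l ∈ T, if i k = j l then (1 : ℂ) else 0) ^ t =
        t.factorial * ∏ k, ∑ l ∈ T, if i k = j l then (1 : ℂ) else 0 := fun T =>
      (factorial_mul_prod _).symm
    rw [Finset.sum_comm]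
    rw [permCount, ← ryser_permanent (fun k l => if i k = j l then (1 : ℂ) else 0),
      Finset.mul_sum, Finset.mul_sum]
    refine Finset.sum_congr rfl fun T _ => ?_
    rw [mul_left_comm (t.factorial : ℂ), ← h2, Finset.mul_sum, Finset.mul_sum]
    refine Finset.sum_congr rfl fun S _ => ?_
    ring
  field_simp
  have := mul_left_cancel₀ ht (key.trans (by ring : _ = (t.factorial : ℂ) * (C * permCount i j)))
  linear_combination this

/-- In `moment_eq_of_linForm` the constant `C` is determined by the trace, that is, by
`∑ a, Z a * W a = 1`. -/
theorem moment_eq_rhoSym [NeZero d] (E : A →ₗ[ℂ] ℂ) (Z W : Fin d → A) (t : ℕ) (C : ℂ)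
    (hE : E 1 = 1) (hZW : ∑ a, Z a * W a = 1)
    (h : ∀ u w : Fin d → ℝ,
      E (linForm Z u ^ t * linForm W w ^ t) = C * ((u ⬝ᵥ w : ℝ) : ℂ) ^ t)
    (i j : Fin t → Fin d) :
    E ((∏ k, Z (i k)) * ∏ k, W (j k)) = rhoSym d t i j := by
  have hm := moment_eq_of_linForm E Z W t C h
  have htr : C / t.factorial * ∏ k ∈ Finset.range t, ((d : ℂ) + (k : ℂ)) = 1 := by
    rw [← sum_permCount_self, Finset.mul_sum, ← Finset.sum_congr rfl fun i _ => hm i i, ← map_sum,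
      ← hE]
    congr 1
    simp_rw [← Finset.prod_mul_distrib]
    rw [← Fintype.prod_sum (fun (_ : Fin t) a => Z a * W a)]
    simp [hZW]
  rw [hm, rhoSym_apply, eq_one_div_of_mul_eq_one_left htr]

end Algebra

/-! ### Orthogonally invariant functionals -/

/-- Prescribed orthonormal rows extend to an orthogonal matrix. -/
theorem exists_orthGroup_rows {d : ℕ} (s : Set (Fin d)) (v : Fin d → Fin d → ℝ)
    (hv : ∀ i ∈ s, ∀ j ∈ s, v i ⬝ᵥ v j = if i = j then 1 else 0) :
    ∃ O : OrthGroup d, ∀ i ∈ s, (O : Matrix (Fin d) (Fin d) ℝ) i = v i := by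
  have hon : Orthonormal ℝ (s.domRestrict fun i => (WithLp.toLp 2 (v i) :
      EuclideanSpace ℝ (Fin d))) := by
    rw [orthonormal_iff_ite]
    rintro ⟨i, hi⟩ ⟨j, hj⟩
    have := hv j hj i hi
    simp only [Set.domRestrict_apply, EuclideanSpace.inner_toLp_toLp, star_trivial, this,
      Subtype.mk.injEq, eq_comm]
  obtain ⟨b, hb⟩ := hon.exists_orthonormalBasis_extension_of_card_eq (by simp)
  refine ⟨⟨Matrix.of fun i j => b i j, ?_⟩, ?_⟩
  · rw [mem_orthGroup_iff]
    ext i j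
    have := orthonormal_iff_ite.mp b.orthonormal j i
    simp only [PiLp.inner_apply, RCLike.inner_apply, conj_trivial] at this
    simp [Matrix.mul_apply, Matrix.one_apply, this, eq_comm]
  · intro i hi
    ext j
    simp [hb i hi]

section Algebra

variable {A : Type*} [CommRing A] [Algebra ℂ A] {d : ℕ}

theorem linForm_add (Z : Fin d → A) (u v : Fin d → ℝ) :
    linForm Z (u + v) = linForm Z u + linForm Z v := by
  simp [linForm, add_smul, Finset.sum_add_distrib]

theorem linForm_sub (Z : Fin d → A) (u v : Fin d → ℝ) :
    linForm Z (u - v) = linForm Z u - linForm Z v := by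
  simp [linForm, sub_smul, Finset.sum_sub_distrib]

theorem linForm_smul (Z : Fin d → A) (r : ℝ) (u : Fin d → ℝ) :
    linForm Z (r • u) = (r : ℂ) • linForm Z u := by
  simp [linForm, mul_smul, Finset.smul_sum]

theorem linForm_zero (Z : Fin d → A) : linForm Z 0 = 0 := by
  simp [linForm]

theorem linForm_single (Z : Fin d → A) (p : Fin d) : linForm Z (Pi.single p 1) = Z p := by
  simpa using linForm_sum_single Z (fun _ : Unit => p) {()}

/-- The joint moments of `Z` and `W` under `E` do not change when an orthogonal matrix acts on
both tuples. The action is encoded as an algebra endomorphism of the algebra of random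
variables. -/
def IsOrthInvariant (E : A →ₗ[ℂ] ℂ) (Z W : Fin d → A) : Prop :=
  ∀ O : OrthGroup d, ∃ φ : A →ₐ[ℂ] A, (∀ a, E (φ a) = E a) ∧
    (∀ p, φ (Z p) = linForm Z ((O : Matrix (Fin d) (Fin d) ℝ) p)) ∧
    ∀ p, φ (W p) = linForm W ((O : Matrix (Fin d) (Fin d) ℝ) p)

variable {E : A →ₗ[ℂ] ℂ} {Z W : Fin d → A}

theorem IsOrthInvariant.symm (h : IsOrthInvariant E Z W) : IsOrthInvariant E W Z := fun O =>
  (h O).imp fun _ hφ => ⟨hφ.1, hφ.2.2, hφ.2.1⟩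

theorem IsOrthInvariant.exists_unit (h : IsOrthInvariant E Z W) (p : Fin d) {v : Fin d → ℝ}
    (hv : v ⬝ᵥ v = 1) :
    ∃ φ : A →ₐ[ℂ] A, (∀ a, E (φ a) = E a) ∧ φ (Z p) = linForm Z v ∧ φ (W p) = linForm W v := by
  obtain ⟨O, hO⟩ := exists_orthGroup_rows {p} (fun _ => v) (by simp [hv])
  obtain ⟨φ, h1, h2, h3⟩ := h O
  exact ⟨φ, h1, by rw [h2, hO p rfl], by rw [h3, hO p rfl]⟩

theorem IsOrthInvariant.exists_pair (h : IsOrthInvariant E Z W) {p q : Fin d} (hpq : p ≠ q)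
    {v w : Fin d → ℝ} (hv : v ⬝ᵥ v = 1) (hw : w ⬝ᵥ w = 1) (hvw : v ⬝ᵥ w = 0) :
    ∃ φ : A →ₐ[ℂ] A, (∀ a, E (φ a) = E a) ∧ φ (Z p) = linForm Z v ∧ φ (W p) = linForm W v ∧
      φ (Z q) = linForm Z w ∧ φ (W q) = linForm W w := by
  obtain ⟨O, hO⟩ := exists_orthGroup_rows {p, q} (fun i => if i = p then v else w) (by
    have hwv : w ⬝ᵥ v = 0 := by rw [dotProduct_comm, hvw]
    simp [hv, hw, hvw, hwv, hpq, hpq.symm])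
  obtain ⟨φ, h1, h2, h3⟩ := h O
  have hp := hO p (by simp)
  have hq := hO q (by simp)
  simp only [if_true, hpq.symm, if_false] at hp hq
  exact ⟨φ, h1, by rw [h2, hp], by rw [h3, hp], by rw [h2, hq], by rw [h3, hq]⟩

theorem IsOrthInvariant.moment_linForm (h : IsOrthInvariant E Z W) (p : Fin d) {a b k : ℕ}
    (hab : a + b = 2 * k) (u : Fin d → ℝ) :
    E (linForm Z u ^ a * linForm W u ^ b) = ((u ⬝ᵥ u : ℝ) : ℂ) ^ k * E (Z p ^ a * W p ^ b) := by
  by_cases hu : u = 0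
  · subst hu
    rcases Nat.eq_zero_or_pos k with rfl | hk
    · obtain ⟨rfl, rfl⟩ : a = 0 ∧ b = 0 := by omega
      simp
    · have : (0 : A) ^ a * 0 ^ b = 0 := by rw [← pow_add, zero_pow (by omega)]
      simp [linForm_zero, this, hk.ne']
  · have hpos : 0 < u ⬝ᵥ u :=
      lt_of_le_of_ne (Finset.sum_nonneg fun i _ => mul_self_nonneg _)
        (fun h0 => hu (dotProduct_self_eq_zero.mp h0.symm))
    set r := Real.sqrt (u ⬝ᵥ u) with hr
    have hrr : r * r = u ⬝ᵥ u := Real.mul_self_sqrt hpos.le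
    have hr0 : r ≠ 0 := (Real.sqrt_pos.mpr hpos).ne'
    obtain ⟨φ, h1, h2, h3⟩ := h.exists_unit p (v := r⁻¹ • u) (by
      rw [smul_dotProduct, dotProduct_smul, ← hrr]; simp only [smul_eq_mul]; field_simp)
    have hu' : ∀ Y : Fin d → A, linForm Y u = (r : ℂ) • linForm Y (r⁻¹ • u) := fun Y => by
      rw [← linForm_smul, smul_smul, mul_inv_cancel₀ hr0, one_smul]
    rw [hu' Z, hu' W, ← h2, ← h3, smul_pow, smul_pow, smul_mul_smul_comm, ← pow_add,
      hab, map_smul, ← map_pow, ← map_pow, ← map_mul, h1, pow_mul, sq, ← hrr, smul_eq_mul]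
    push_cast
    rfl

theorem IsOrthInvariant.moment_eq (h : IsOrthInvariant E Z W) (p q : Fin d) (a b : ℕ) :
    E (Z q ^ a * W q ^ b) = E (Z p ^ a * W p ^ b) := by
  obtain ⟨φ, h1, h2, h3⟩ := h.exists_unit p (v := Pi.single q 1) (by simp)
  rw [← h1 (Z p ^ a * W p ^ b), map_mul φ, map_pow φ, map_pow φ, h2, h3, linForm_single,
    linForm_single]

theorem IsOrthInvariant.sum_moment (h : IsOrthInvariant E Z W) (p : Fin d) (a b : ℕ) :
    E (∑ q, Z q ^ a * W q ^ b) = d * E (Z p ^ a * W p ^ b) := by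
  simp [h.moment_eq p]

/-- Averaging a moment over the vectors `e_p ± e_q`: the squared lengths are `4` and `0` for
`p = q` and `2` otherwise. Comparing with the expansion of the left-hand side determines the
moment, in place of a Laplacian. -/
theorem IsOrthInvariant.sum_add_sub (h : IsOrthInvariant E Z W) (r : Fin d) {a b k : ℕ}
    (hab : a + b = 2 * k) (hk : k ≠ 0) :
    E (∑ p, ∑ q, ((Z p + Z q) ^ a * (W p + W q) ^ b + (Z p - Z q) ^ a * (W p - W q) ^ b)) =
      (d * 4 ^ k + (d ^ 2 - d) * (2 * 2 ^ k)) * E (Z r ^ a * W r ^ b) := by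
  have hpq : ∀ p q : Fin d,
      E ((Z p + Z q) ^ a * (W p + W q) ^ b + (Z p - Z q) ^ a * (W p - W q) ^ b) =
        (2 * 2 ^ k + if p = q then 4 ^ k - 2 * 2 ^ k else 0) * E (Z r ^ a * W r ^ b) := by
    intro p q
    have h1 := h.moment_linForm r hab (Pi.single p 1 + Pi.single q 1)
    have h2 := h.moment_linForm r hab (Pi.single p 1 - Pi.single q 1)
    simp only [linForm_add, linForm_sub, linForm_single] at h1 h2
    rw [map_add, h1, h2, ← add_mul]
    congr 1
    by_cases hpq : p = q
    · subst hpq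
      simp [hk]
      norm_num
    · simp [hpq, Ne.symm hpq]
      norm_num
      ring
  simp only [map_sum, hpq, ← Finset.sum_mul]
  congr 1
  simp [Finset.sum_add_distrib]
  ring

theorem map_natCast_mul (E : A →ₗ[ℂ] ℂ) (n : ℕ) (x : A) : E ((n : A) * x) = n * E x := by
  rw [← nsmul_eq_mul, map_nsmul, nsmul_eq_mul]

/-! The next lemmas evaluate the pure moments in one coordinate, in terms of the contractions
`∑ a, Z a ^ 2 = σ`, `∑ a, W a ^ 2 = τ` and `∑ a, Z a * W a = 1`. -/

theorem IsOrthInvariant.moment_two_zero (h : IsOrthInvariant E Z W) (hE : E 1 = 1) {σ : ℂ}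
    (hZZ : ∑ a, Z a ^ 2 = σ • 1) (p : Fin d) : d * E (Z p ^ 2) = σ := by
  have := h.sum_moment p 2 0
  simp only [pow_zero, mul_one] at this
  rw [← this, hZZ, map_smul, hE, smul_eq_mul, mul_one]

theorem IsOrthInvariant.moment_four_zero [NeZero d] (h : IsOrthInvariant E Z W) (hE : E 1 = 1)
    {σ : ℂ} (hZZ : ∑ a, Z a ^ 2 = σ • 1) (p : Fin d) :
    (d * (d + 2) : ℂ) * E (Z p ^ 4) = 3 * σ ^ 2 := by
  have h1 := h.sum_add_sub p (a := 4) (b := 0) (k := 2) rfl two_ne_zero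
  have hS := h.sum_moment p 4 0
  simp only [pow_zero, mul_one] at h1 hS
  have h2 : ∑ p, ∑ q, ((Z p + Z q) ^ 4 + (Z p - Z q) ^ 4) =
      ((4 * d : ℕ) : A) * ∑ q, Z q ^ 4 + ((12 : ℕ) : A) * ((∑ q, Z q ^ 2) * ∑ q, Z q ^ 2) := by
    have : ∀ x y : A, (x + y) ^ 4 + (x - y) ^ 4 = 2 * x ^ 4 + 2 * y ^ 4 + 12 * (x ^ 2 * y ^ 2) :=
      fun x y => by ring
    simp only [this, Finset.sum_add_distrib, Finset.sum_const, Finset.card_univ, Fintype.card_fin,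
      nsmul_eq_mul]
    simp only [← Finset.mul_sum, ← Finset.sum_mul]
    push_cast
    ring
  rw [h2, map_add, map_natCast_mul, map_natCast_mul, hS, hZZ, smul_mul_smul_comm, one_mul,
    map_smul, hE] at h1
  push_cast at h1
  simp only [smul_eq_mul] at h1
  linear_combination (-1 / 4) * h1

theorem IsOrthInvariant.moment_three_one [NeZero d] (h : IsOrthInvariant E Z W) (hE : E 1 = 1)
    (hZW : ∑ a, Z a * W a = 1) {σ : ℂ} (hZZ : ∑ a, Z a ^ 2 = σ • 1) (p : Fin d) :
    (d * (d + 2) : ℂ) * E (Z p ^ 3 * W p) = 3 * σ := by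
  have h1 := h.sum_add_sub p (a := 3) (b := 1) (k := 2) rfl two_ne_zero
  have hS := h.sum_moment p 3 1
  simp only [pow_one] at h1 hS
  have h2 : ∑ p, ∑ q, ((Z p + Z q) ^ 3 * (W p + W q) + (Z p - Z q) ^ 3 * (W p - W q)) =
      ((4 * d : ℕ) : A) * ∑ q, Z q ^ 3 * W q +
        ((12 : ℕ) : A) * ((∑ q, Z q ^ 2) * ∑ q, Z q * W q) := by
    have : ∀ p q, (Z p + Z q) ^ 3 * (W p + W q) + (Z p - Z q) ^ 3 * (W p - W q) =
        2 * (Z p ^ 3 * W p) + 2 * (Z q ^ 3 * W q) + 6 * (Z p ^ 2 * (Z q * W q)) +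
          6 * ((Z p * W p) * Z q ^ 2) := fun p q => by ring
    simp only [this, Finset.sum_add_distrib, Finset.sum_const, Finset.card_univ, Fintype.card_fin,
      nsmul_eq_mul]
    simp only [← Finset.mul_sum, ← Finset.sum_mul]
    push_cast
    ring
  rw [h2, map_add, map_natCast_mul, map_natCast_mul, hS, hZZ, hZW, mul_one, map_smul, hE] at h1
  push_cast at h1
  simp only [smul_eq_mul] at h1
  linear_combination (-1 / 4) * h1

theorem IsOrthInvariant.moment_two_two [NeZero d] (h : IsOrthInvariant E Z W) (hE : E 1 = 1)
    (hZW : ∑ a, Z a * W a = 1) {σ τ : ℂ} (hZZ : ∑ a, Z a ^ 2 = σ • 1)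
    (hWW : ∑ a, W a ^ 2 = τ • 1) (p : Fin d) :
    (d * (d + 2) : ℂ) * E (Z p ^ 2 * W p ^ 2) = σ * τ + 2 := by
  have h1 := h.sum_add_sub p (a := 2) (b := 2) (k := 2) rfl two_ne_zero
  have hS := h.sum_moment p 2 2
  have h2 : ∑ p, ∑ q, ((Z p + Z q) ^ 2 * (W p + W q) ^ 2 + (Z p - Z q) ^ 2 * (W p - W q) ^ 2) =
      ((4 * d : ℕ) : A) * ∑ q, Z q ^ 2 * W q ^ 2 +
        (((4 : ℕ) : A) * ((∑ q, Z q ^ 2) * ∑ q, W q ^ 2) +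
          ((8 : ℕ) : A) * ((∑ q, Z q * W q) * ∑ q, Z q * W q)) := by
    have : ∀ p q, (Z p + Z q) ^ 2 * (W p + W q) ^ 2 + (Z p - Z q) ^ 2 * (W p - W q) ^ 2 =
        2 * (Z p ^ 2 * W p ^ 2) + 2 * (Z q ^ 2 * W q ^ 2) + 2 * (Z p ^ 2 * W q ^ 2) +
          2 * (W p ^ 2 * Z q ^ 2) + 8 * ((Z p * W p) * (Z q * W q)) := fun p q => by ring
    simp only [this, Finset.sum_add_distrib, Finset.sum_const, Finset.card_univ, Fintype.card_fin,
      nsmul_eq_mul]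
    simp only [← Finset.mul_sum, ← Finset.sum_mul]
    push_cast
    ring
  rw [h2, map_add, map_add, map_natCast_mul, map_natCast_mul, map_natCast_mul, hS, hZZ, hZW, hWW,
    smul_mul_smul_comm, mul_one, map_smul, hE] at h1
  push_cast at h1
  simp only [smul_eq_mul] at h1
  linear_combination (-1 / 4) * h1

theorem IsOrthInvariant.moment_three_three [NeZero d] (h : IsOrthInvariant E Z W)
    (hZW : ∑ a, Z a * W a = 1) {σ τ : ℂ} (hZZ : ∑ a, Z a ^ 2 = σ • 1)
    (hWW : ∑ a, W a ^ 2 = τ • 1) (p : Fin d) :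
    (d + 4 : ℂ) * E (Z p ^ 3 * W p ^ 3) =
      σ * E (W p ^ 3 * Z p) + 3 * E (Z p ^ 2 * W p ^ 2) + τ * E (Z p ^ 3 * W p) := by
  have h1 := h.sum_add_sub p (a := 3) (b := 3) (k := 3) rfl three_ne_zero
  have hS := h.sum_moment p 3 3
  have hS22 := h.sum_moment p 2 2
  have hS31 := h.sum_moment p 3 1
  have hS13 := h.symm.sum_moment p 3 1
  simp only [pow_one] at hS31 hS13
  have h2 : ∑ p, ∑ q, ((Z p + Z q) ^ 3 * (W p + W q) ^ 3 + (Z p - Z q) ^ 3 * (W p - W q) ^ 3) =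
      ((4 * d : ℕ) : A) * ∑ q, Z q ^ 3 * W q ^ 3 +
        (((12 : ℕ) : A) * ((∑ q, Z q ^ 2) * ∑ q, W q ^ 3 * Z q) +
          (((12 : ℕ) : A) * ((∑ q, W q ^ 2) * ∑ q, Z q ^ 3 * W q) +
          ((36 : ℕ) : A) * ((∑ q, Z q * W q) * ∑ q, Z q ^ 2 * W q ^ 2))) := by
    have : ∀ p q, (Z p + Z q) ^ 3 * (W p + W q) ^ 3 + (Z p - Z q) ^ 3 * (W p - W q) ^ 3 =
        2 * (Z p ^ 3 * W p ^ 3) + 2 * (Z q ^ 3 * W q ^ 3) +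
          6 * ((W p ^ 3 * Z p) * Z q ^ 2) + 6 * (Z p ^ 2 * (W q ^ 3 * Z q)) +
          6 * ((Z p ^ 3 * W p) * W q ^ 2) + 6 * (W p ^ 2 * (Z q ^ 3 * W q)) +
          18 * ((Z p ^ 2 * W p ^ 2) * (Z q * W q)) +
          18 * ((Z p * W p) * (Z q ^ 2 * W q ^ 2)) := fun p q => by ring
    simp only [this, Finset.sum_add_distrib, Finset.sum_const, Finset.card_univ, Fintype.card_fin,
      nsmul_eq_mul]
    simp only [← Finset.mul_sum, ← Finset.sum_mul]
    push_cast
    ring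
  rw [h2, map_add, map_add, map_add, map_natCast_mul, map_natCast_mul, map_natCast_mul,
    map_natCast_mul, hZZ, hZW, hWW, smul_mul_assoc, smul_mul_assoc, one_mul, one_mul, one_mul,
    map_smul, map_smul, hS, hS22, hS31, hS13] at h1
  push_cast at h1
  simp only [smul_eq_mul] at h1
  have hd : (d : ℂ) ≠ 0 := by exact_mod_cast NeZero.ne d
  refine mul_left_cancel₀ hd ?_
  linear_combination (-1 / 12) * h1

/-- The only mixed moment of order `(3, 3)` that symmetry does not kill. By rotation about `e_p` it
is the same for all `q ≠ p`, and the sum over all `q` is `τ * E (Z p ^ 3 * W p)`. -/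
theorem IsOrthInvariant.mixed_moment_eq_zero [NeZero d] (h : IsOrthInvariant E Z W) (hE : E 1 = 1)
    (hZW : ∑ a, Z a * W a = 1) {σ τ : ℂ} (hZZ : ∑ a, Z a ^ 2 = σ • 1)
    (hWW : ∑ a, W a ^ 2 = τ • 1) (hστ : σ * τ = 2 / (d + 1)) {p q : Fin d} (hpq : p ≠ q) :
    E (Z p ^ 3 * (W p * W q ^ 2)) = 0 := by
  have heq : ∀ r, r ≠ p → E (Z p ^ 3 * (W p * W r ^ 2)) = E (Z p ^ 3 * (W p * W q ^ 2)) := by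
    intro r hr
    obtain ⟨φ, h1, h2, h3, -, h5⟩ := h.exists_pair hpq (v := Pi.single p 1) (w := Pi.single r 1)
      (by simp) (by simp) (by simp [hr.symm])
    rw [← h1 (Z p ^ 3 * (W p * W q ^ 2))]
    simp only [map_mul φ, map_pow φ, h2, h3, h5, linForm_single]
  have hsum : E (∑ r, Z p ^ 3 * (W p * W r ^ 2)) = τ * E (Z p ^ 3 * W p) := by
    simp only [← Finset.mul_sum, hWW]
    rw [mul_smul_comm, mul_smul_comm, map_smul, mul_one, smul_eq_mul]
  rw [map_sum, ← Finset.add_sum_erase _ _ (Finset.mem_univ p),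
    Finset.sum_congr rfl fun r hr => heq r (Finset.ne_of_mem_erase hr), Finset.sum_const,
    Finset.card_erase_of_mem (Finset.mem_univ p), Finset.card_univ, Fintype.card_fin, nsmul_eq_mul,
    Nat.cast_sub (NeZero.one_le), show Z p ^ 3 * (W p * W p ^ 2) = Z p ^ 3 * W p ^ 3 by ring]
    at hsum
  have m31 := h.moment_three_one hE hZW hZZ p
  have m13 := h.symm.moment_three_one hE (by simpa only [mul_comm] using hZW) hWW p
  have m22 := h.moment_two_two hE hZW hZZ hWW p
  have m33 := h.moment_three_three hZW hZZ hWW p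
  have hd : (d : ℂ) ≠ 0 := by exact_mod_cast NeZero.ne d
  have hd1 : (d : ℂ) + 1 ≠ 0 := by exact_mod_cast Nat.succ_ne_zero d
  have hd2 : (d : ℂ) + 2 ≠ 0 := by exact_mod_cast Nat.succ_ne_zero (d + 1)
  have hd4 : (d : ℂ) + 4 ≠ 0 := by exact_mod_cast Nat.succ_ne_zero (d + 3)
  have hdm : (d : ℂ) - 1 ≠ 0 := by
    intro h0
    have : d = 1 := by exact_mod_cast sub_eq_zero.mp h0
    subst this
    exact hpq (Subsingleton.elim _ _)
  rw [eq_div_iff hd1] at hστ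
  push_cast at hsum
  -- eliminate the pure moments from `hsum`; what remains is a multiple of `σ τ (d + 1) - 2`
  have h0 : ((d : ℂ) * (d + 1) * (d + 2) * (d + 4) * (d - 1)) * E (Z p ^ 3 * (W p * W q ^ 2)) =
      0 := by
    linear_combination (d * (d + 1) * (d + 2) * (d + 4) : ℂ) * hsum -
      (d * (d + 1) * (d + 2) : ℂ) * m33 - σ * (d + 1) * m13 + (d + 4 - 1) * (d + 1) * τ * m31 -
      3 * (d + 1) * m22 + (3 * (d + 4) - 9) * hστ
  exact (mul_eq_zero.mp h0).resolve_left (by simp [hd, hd1, hd2, hd4, hdm])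

/-- Two-point reduction: an orthogonal matrix moves `u` to a multiple of `e_p` and `w` to a
combination of `e_p` and `e_q`, so the moments in the coordinates `p` and `q` decide. -/
theorem IsOrthInvariant.moment_linForm_linForm [NeZero d] (h : IsOrthInvariant E Z W) {t : ℕ}
    {C : ℂ} (hC : ∀ p, E (Z p ^ t * W p ^ t) = C)
    (hmix : ∀ p q, p ≠ q → ∀ k < t, E (Z p ^ t * (W p ^ k * W q ^ (t - k))) = 0)
    (u w : Fin d → ℝ) :
    E (linForm Z u ^ t * linForm W w ^ t) = C * ((u ⬝ᵥ w : ℝ) : ℂ) ^ t := by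
  by_cases hu : u = 0
  · subst hu
    rcases Nat.eq_zero_or_pos t with rfl | ht
    · simpa using hC 0
    · simp [linForm_zero, ht.ne']
  have hpos : ∀ v : Fin d → ℝ, v ≠ 0 → ∃ r : ℝ, r ≠ 0 ∧ v ⬝ᵥ v = r * r := fun v hv =>
    have hv' : 0 < v ⬝ᵥ v := lt_of_le_of_ne (Finset.sum_nonneg fun i _ => mul_self_nonneg _)
      (fun h0 => hv (dotProduct_self_eq_zero.mp h0.symm))
    ⟨Real.sqrt (v ⬝ᵥ v), (Real.sqrt_pos.mpr hv').ne', (Real.mul_self_sqrt hv'.le).symm⟩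
  obtain ⟨r, hr0, hr⟩ := hpos u hu
  set e := r⁻¹ • u with he
  have hue : u = r • e := by rw [he, smul_smul, mul_inv_cancel₀ hr0, one_smul]
  have hee : e ⬝ᵥ e = 1 := by
    rw [he, smul_dotProduct, dotProduct_smul, hr]
    simp only [smul_eq_mul]
    field_simp
  set c := e ⬝ᵥ w with hc
  -- `s` is the length of the component of `w` orthogonal to `u`
  obtain ⟨p, q, s, φ, hpq, h1, h2, h3⟩ : ∃ (p q : Fin d) (s : ℝ) (φ : A →ₐ[ℂ] A),
      (p ≠ q ∨ s = 0) ∧ (∀ a, E (φ a) = E a) ∧ φ (Z p) = linForm Z e ∧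
        φ ((c : ℂ) • W p + (s : ℂ) • W q) = linForm W w := by
    by_cases hw : w - c • e = 0
    · obtain ⟨φ, h1, h2, h3⟩ := h.exists_unit 0 hee
      refine ⟨0, 0, 0, φ, Or.inr rfl, h1, h2, ?_⟩
      rw [sub_eq_zero.mp hw, linForm_smul, map_add, map_smul, map_smul, h3, Complex.ofReal_zero,
        zero_smul, add_zero]
    · obtain ⟨s, hs0, hs⟩ := hpos _ hw
      set f := s⁻¹ • (w - c • e) with hf
      have hff : f ⬝ᵥ f = 1 := by
        rw [hf, smul_dotProduct, dotProduct_smul, hs]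
        simp only [smul_eq_mul]
        field_simp
      have hef : e ⬝ᵥ f = 0 := by
        rw [hf, dotProduct_smul, dotProduct_sub, dotProduct_smul, hee, ← hc]
        simp
      have hwf : w = c • e + s • f := by
        rw [hf, smul_inv_smul₀ hs0]
        abel
      have hd : Nontrivial (Fin d) := by
        by_contra hd
        rw [not_nontrivial_iff_subsingleton] at hd
        have hz : ∀ x y : Fin d → ℝ, x ⬝ᵥ y = x 0 * y 0 := fun x y => by
          rw [dotProduct, Fintype.sum_subsingleton _ 0]
        rw [hz] at hee hef hff
        rcases mul_eq_zero.mp hef with h0 | h0 <;> simp [h0] at hee hff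
      obtain ⟨p, q, hpq⟩ := hd
      obtain ⟨φ, h1, h2, h3, -, h5⟩ := h.exists_pair hpq hee hff hef
      refine ⟨p, q, s, φ, Or.inl hpq, h1, h2, ?_⟩
      rw [map_add, map_smul, map_smul, h3, h5, ← linForm_smul, ← linForm_smul, ← linForm_add,
        ← hwf]
  rw [hue, linForm_smul, ← h2, ← h3, smul_pow, smul_mul_assoc, map_smul, ← map_pow φ, ← map_pow φ,
    ← map_mul φ, h1, add_pow, Finset.mul_sum, map_sum, Finset.sum_range_succ,
    Finset.sum_eq_zero, smul_dotProduct, ← hc]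
  · simp [smul_pow, hC]
    ring
  · intro k hk
    rw [Finset.mem_range] at hk
    have hmul : Z p ^ t * (((c : ℂ) • W p) ^ k * ((s : ℂ) • W q) ^ (t - k) * (t.choose k : A)) =
        (t.choose k : A) * (((c : ℂ) ^ k * (s : ℂ) ^ (t - k)) •
          (Z p ^ t * (W p ^ k * W q ^ (t - k)))) := by
      simp only [Algebra.smul_def, map_mul, map_pow]
      ring
    rw [hmul, map_natCast_mul, map_smul]
    rcases hpq with hpq | rfl
    · simp [hmix p q hpq k hk]
    · simp [(Nat.sub_pos_of_lt hk).ne']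

end Algebra

/-! ### Haar averages of continuous functions -/

-- Shortcut instances: the general instance is slow to unify with the two groups.
instance compactSpace_orthGroup (d : ℕ) : CompactSpace (OrthGroup d) :=
  compactSpace_unitaryGroup ℝ d

instance compactSpace_unitGroup (d : ℕ) : CompactSpace (UnitGroup d) :=
  compactSpace_unitaryGroup ℂ d

section Haar

variable {G : Type} [Group G] [TopologicalSpace G] [IsTopologicalGroup G]

/-- Left translation of functions. -/
noncomputable def leftTranslate (h : G) : C(G, ℂ) →ₐ[ℂ] C(G, ℂ) :=
  ContinuousMap.compRightAlgHom ℂ ℂ ⟨fun g => h * g, by fun_prop⟩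

theorem leftTranslate_apply (h : G) (f : C(G, ℂ)) (g : G) : leftTranslate h f g = f (h * g) := rfl

variable [CompactSpace G] [MeasurableSpace G] [BorelSpace G]

instance : IsProbabilityMeasure (haarProb G) :=
  ⟨by simpa [haarProb] using
    Measure.haarMeasure_self (K₀ := (⊤ : TopologicalSpace.PositiveCompacts G))⟩

instance : (haarProb G).IsMulLeftInvariant := by
  unfold haarProb; infer_instance

theorem integrable_haarProb (f : C(G, ℂ)) : Integrable f (haarProb G) :=
  f.continuous.integrable_of_hasCompactSupport (HasCompactSupport.of_compactSpace f)

variable (G) in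
/-- Integration against the Haar probability measure, as a linear functional. -/
noncomputable def haarMean : C(G, ℂ) →ₗ[ℂ] ℂ where
  toFun f := ∫ g, f g ∂(haarProb G)
  map_add' f g := integral_add (integrable_haarProb f) (integrable_haarProb g)
  map_smul' c f := integral_const_mul c f

theorem haarMean_apply (f : C(G, ℂ)) : haarMean G f = ∫ g, f g ∂(haarProb G) := rfl

theorem haarMean_one : haarMean G 1 = 1 := by
  simp [haarMean_apply]

theorem haarMean_leftTranslate (h : G) (f : C(G, ℂ)) :
    haarMean G (leftTranslate h f) = haarMean G f :=
  integral_mul_left_eq_self (fun g => f g) h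

end Haar

theorem linForm_apply {X : Type} [TopologicalSpace X] {d : ℕ} (Z : Fin d → C(X, ℂ))
    (u : Fin d → ℝ) (x : X) : linForm Z u x = ∑ a, (u a : ℂ) * Z a x := by
  simp [linForm]

/-! ### The random vector `O ψ` -/

theorem orthToComplex_transpose_mul {d : ℕ} (O : OrthGroup d) :
    (orthToComplex O).transpose * orthToComplex O = 1 := by
  have h : (O : Matrix (Fin d) (Fin d) ℝ).transpose * (O : Matrix (Fin d) (Fin d) ℝ) = 1 :=
    mul_eq_one_comm.mp (mem_orthGroup_iff.mp O.2)
  have := congrArg (fun M : Matrix (Fin d) (Fin d) ℝ => M.map Complex.ofRealHom) h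
  rwa [Matrix.map_mul, Matrix.transpose_map, Matrix.map_one _ (map_zero _) (map_one _)] at this

theorem orthToComplex_mul {d : ℕ} (P O : OrthGroup d) :
    orthToComplex (P * O) = orthToComplex P * orthToComplex O := by
  exact Matrix.map_mul (f := Complex.ofRealHom) (L := (P : Matrix (Fin d) (Fin d) ℝ))
    (M := (O : Matrix (Fin d) (Fin d) ℝ))

theorem continuous_orthToComplex (d : ℕ) : Continuous (orthToComplex (d := d)) :=
  continuous_subtype_val.matrix_map Complex.continuous_ofReal

/-- The coordinate `(O ψ)_p` as a function of `O`. -/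
noncomputable def orthCoord {d : ℕ} (ψ : EuclideanSpace ℂ (Fin d)) (p : Fin d) :
    C(OrthGroup d, ℂ) :=
  ⟨fun O => (orthToComplex O).mulVec ψ.ofLp p,
    (continuous_apply p).comp ((continuous_orthToComplex d).matrix_mulVec continuous_const)⟩

theorem orthCoord_apply {d : ℕ} (ψ : EuclideanSpace ℂ (Fin d)) (p : Fin d) (O : OrthGroup d) :
    orthCoord ψ p O = (orthToComplex O).mulVec ψ.ofLp p := rfl

theorem orthCoord_mul {d : ℕ} (ψ : EuclideanSpace ℂ (Fin d)) (p : Fin d) (P O : OrthGroup d) :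
    orthCoord ψ p (P * O) = ∑ a, ((P : Matrix (Fin d) (Fin d) ℝ) p a : ℂ) * orthCoord ψ a O := by
  rw [orthCoord_apply, orthToComplex_mul, ← Matrix.mulVec_mulVec]
  rfl

theorem isOrthInvariant_orthCoord {d : ℕ} (ψ : EuclideanSpace ℂ (Fin d)) :
    IsOrthInvariant (haarMean (OrthGroup d)) (orthCoord ψ) (star (orthCoord ψ)) := by
  refine fun P => ⟨leftTranslate P, haarMean_leftTranslate P, fun p => ?_, fun p => ?_⟩
  · ext O
    rw [leftTranslate_apply, orthCoord_mul, linForm_apply]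
  · ext O
    simp only [leftTranslate_apply, Pi.star_apply, ContinuousMap.star_apply, orthCoord_mul,
      linForm_apply, star_sum, star_mul']
    simp

theorem sum_orthCoord_mul_star {d : ℕ} {ψ : EuclideanSpace ℂ (Fin d)} (hψ : ‖ψ‖ = 1) :
    ∑ p, orthCoord ψ p * star (orthCoord ψ) p = 1 := by
  ext O
  have h1 : star ((orthToComplex O).mulVec ψ.ofLp) = (orthToComplex O).mulVec (star ψ.ofLp) := by
    ext p
    simp [Matrix.mulVec, dotProduct, orthToComplex]
  have h2 : (orthToComplex O).mulVec ψ.ofLp ⬝ᵥ star ((orthToComplex O).mulVec ψ.ofLp) =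
      ψ.ofLp ⬝ᵥ star ψ.ofLp := by
    rw [h1, Matrix.dotProduct_mulVec, ← Matrix.mulVec_transpose, Matrix.mulVec_mulVec,
      orthToComplex_transpose_mul, Matrix.one_mulVec]
  have h3 : ψ.ofLp ⬝ᵥ star ψ.ofLp = 1 := by
    rw [← EuclideanSpace.inner_eq_star_dotProduct, inner_self_eq_norm_sq_to_K, hψ]
    simp
  rw [h3] at h2
  simpa [dotProduct, orthCoord_apply] using h2

theorem sum_orthCoord_sq {d : ℕ} (ψ : EuclideanSpace ℂ (Fin d)) :
    ∑ p, orthCoord ψ p ^ 2 = (∑ a, ψ a ^ 2) • (1 : C(OrthGroup d, ℂ)) := by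
  ext O
  have h2 : (orthToComplex O).mulVec ψ.ofLp ⬝ᵥ (orthToComplex O).mulVec ψ.ofLp =
      ψ.ofLp ⬝ᵥ ψ.ofLp := by
    rw [Matrix.dotProduct_mulVec, ← Matrix.mulVec_transpose, Matrix.mulVec_mulVec,
      orthToComplex_transpose_mul, Matrix.one_mulVec]
  simpa [dotProduct, orthCoord_apply, sq] using h2

theorem sum_star_orthCoord_sq {d : ℕ} (ψ : EuclideanSpace ℂ (Fin d)) :
    ∑ p, star (orthCoord ψ) p ^ 2 = star (∑ a, ψ a ^ 2) • (1 : C(OrthGroup d, ℂ)) := by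
  have := congrArg star (sum_orthCoord_sq ψ)
  simpa only [star_sum, star_pow, star_smul, star_one, Pi.star_apply] using this

theorem mul_ketBra_mul_apply {d : ℕ} (M N : Matrix (Fin d) (Fin d) ℂ)
    (ψ : EuclideanSpace ℂ (Fin d)) (a b : Fin d) :
    (M * ketBra ψ * N) a b = M.mulVec ψ.ofLp a * Matrix.vecMul (star ψ.ofLp) N b := by
  have : ketBra ψ = Matrix.vecMulVec ψ.ofLp (star ψ.ofLp) := rfl
  rw [this, Matrix.mul_vecMulVec, Matrix.vecMulVec_mul, Matrix.vecMulVec_apply]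

theorem orthTwirl_apply {d t : ℕ} (ψ : EuclideanSpace ℂ (Fin d)) (i j : Fin t → Fin d) :
    orthTwirl t ψ i j = haarMean (OrthGroup d)
      ((∏ k, orthCoord ψ (i k)) * ∏ k, star (orthCoord ψ) (j k)) := by
  rw [haarMean_apply, orthTwirl, Matrix.of_apply]
  congr 1
  ext O
  simp only [tensorPow, Matrix.of_apply, mul_ketBra_mul_apply, Finset.prod_mul_distrib,
    ContinuousMap.mul_apply, ContinuousMap.prod_apply, Pi.star_apply, ContinuousMap.star_apply,
    orthCoord_apply]
  congr 1
  refine Finset.prod_congr rfl fun k _ => ?_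
  rw [Matrix.vecMul_transpose]
  simp [Matrix.mulVec, dotProduct, orthToComplex]

theorem continuous_orbit {d : ℕ} (ψ : EuclideanSpace ℂ (Fin d)) :
    Continuous fun O : OrthGroup d =>
      (WithLp.toLp 2 ((orthToComplex O).mulVec ψ.ofLp) : EuclideanSpace ℂ (Fin d)) :=
  (PiLp.continuous_toLp 2 _).comp ((continuous_orthToComplex d).matrix_mulVec continuous_const)

theorem continuous_tensorPow_ketBra {d t : ℕ} (i j : Fin t → Fin d) :
    Continuous fun φ : EuclideanSpace ℂ (Fin d) => tensorPow t (ketBra φ) i j := by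
  simp only [tensorPow, ketBra, Matrix.of_apply]
  fun_prop

theorem momentOp_orbitLaw {d : ℕ} (t : ℕ) (ψ : EuclideanSpace ℂ (Fin d)) :
    momentOp t (orbitLaw ψ) = orthTwirl t ψ := by
  ext i j
  rw [momentOp, Matrix.of_apply, orbitLaw, integral_map (continuous_orbit ψ).aemeasurable
    (continuous_tensorPow_ketBra i j).aestronglyMeasurable, orthTwirl_apply, haarMean_apply]
  congr 1
  ext O
  simp [tensorPow, ketBra, Finset.prod_mul_distrib, orthCoord_apply]

theorem isProbabilityMeasure_orbitLaw {d : ℕ} (ψ : EuclideanSpace ℂ (Fin d)) :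
    IsProbabilityMeasure (orbitLaw ψ) :=
  Measure.isProbabilityMeasure_map (continuous_orbit ψ).aemeasurable

theorem norm_eq_one_of_orbitLaw {d : ℕ} {ψ : EuclideanSpace ℂ (Fin d)} (hψ : ‖ψ‖ = 1) :
    ∀ᵐ φ ∂(orbitLaw ψ), ‖φ‖ = 1 := by
  rw [orbitLaw, ae_map_iff (continuous_orbit ψ).aemeasurable
    (isClosed_eq continuous_norm continuous_const).measurableSet]
  refine Filter.Eventually.of_forall fun O => ?_
  have h := congrArg (fun f : C(OrthGroup d, ℂ) => f O) (sum_orthCoord_mul_star hψ)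
  have h' : ((∑ p, ‖(orthToComplex O).mulVec ψ.ofLp p‖ ^ 2 : ℝ) : ℂ) = 1 := by
    push_cast
    simpa [Complex.mul_conj', orthCoord_apply] using h
  have h'' : ∑ p, ‖(orthToComplex O).mulVec ψ.ofLp p‖ ^ 2 = 1 := by exact_mod_cast h'
  simp [EuclideanSpace.norm_eq, h'']

theorem orthTwirl_cons {d t : ℕ} {ψ : EuclideanSpace ℂ (Fin d)} (hψ : ‖ψ‖ = 1)
    (i j : Fin t → Fin d) :
    ∑ c, orthTwirl (t + 1) ψ (Fin.cons c i) (Fin.cons c j) = orthTwirl t ψ i j := by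
  simp only [orthTwirl_apply, Fin.prod_univ_succ, Fin.cons_zero, Fin.cons_succ]
  rw [← map_sum]
  rw [Finset.sum_congr rfl fun c _ => mul_mul_mul_comm _ _ _ _, ← Finset.sum_mul,
    sum_orthCoord_mul_star hψ, one_mul]

/-- A partial trace turns a `t`-design identity into the identities of lower order. -/
theorem orthTwirl_eq_rhoSym_of_le {d : ℕ} [NeZero d] {ψ : EuclideanSpace ℂ (Fin d)}
    (hψ : ‖ψ‖ = 1) {s t : ℕ} (hst : s ≤ t) (h : orthTwirl t ψ = rhoSym d t) :
    orthTwirl s ψ = rhoSym d s := by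
  induction hst with
  | refl => exact h
  | step _ ih =>
    refine ih ?_
    ext i j
    rw [← orthTwirl_cons hψ, h, sum_rhoSym_cons]

theorem overlap_eq {d : ℕ} (ψ : EuclideanSpace ℂ (Fin d)) : overlap ψ = ‖∑ a, ψ a ^ 2‖ := by
  simp [overlap, conjVec, PiLp.inner_apply, sq]

theorem sum_sq_mul_star {d : ℕ} (ψ : EuclideanSpace ℂ (Fin d)) :
    (∑ a, ψ a ^ 2) * star (∑ a, ψ a ^ 2) = (overlap ψ ^ 2 : ℝ) := by
  rw [overlap_eq, Complex.star_def, Complex.mul_conj']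
  push_cast
  rfl

/-! ### The Haar random state -/

/-- The first column of a unitary matrix: the coordinates of `U |0⟩`. -/
def unitCoord {d : ℕ} [NeZero d] (p : Fin d) : C(UnitGroup d, ℂ) :=
  ⟨fun U => (U : Matrix (Fin d) (Fin d) ℂ) p 0, continuous_subtype_val.matrix_elem p 0⟩

theorem unitCoord_apply {d : ℕ} [NeZero d] (p : Fin d) (U : UnitGroup d) :
    unitCoord p U = (U : Matrix (Fin d) (Fin d) ℂ) p 0 := rfl

theorem unitCoord_mul {d : ℕ} [NeZero d] (p : Fin d) (V U : UnitGroup d) :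
    unitCoord p (V * U) = ∑ a, (V : Matrix (Fin d) (Fin d) ℂ) p a * unitCoord a U := rfl

/-- Orthogonal matrices are unitary, so Haar invariance on `U(d)` contains invariance under
`O(d)`. -/
theorem isOrthInvariant_unitCoord {d : ℕ} [NeZero d] :
    IsOrthInvariant (haarMean (UnitGroup d)) (unitCoord (d := d)) (star unitCoord) := by
  intro P
  have hP : orthToComplex P ∈ Matrix.unitaryGroup (Fin d) ℂ := by
    rw [Matrix.mem_unitaryGroup_iff', Matrix.star_eq_conjTranspose]
    convert orthToComplex_transpose_mul P using 2
    ext a b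
    simp [orthToComplex]
  refine ⟨leftTranslate ⟨_, hP⟩, haarMean_leftTranslate _, fun p => ?_, fun p => ?_⟩
  · ext U
    rw [leftTranslate_apply, unitCoord_mul, linForm_apply]
    rfl
  · ext U
    simp only [leftTranslate_apply, Pi.star_apply, ContinuousMap.star_apply, unitCoord_mul,
      linForm_apply, star_sum, star_mul']
    simp [orthToComplex]

theorem sum_unitCoord_mul_star {d : ℕ} [NeZero d] :
    ∑ p : Fin d, unitCoord p * star unitCoord p = 1 := by
  ext U
  have h := congrFun (congrFun (Matrix.mem_unitaryGroup_iff'.mp U.2) 0) 0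
  simpa [Matrix.mul_apply, unitCoord_apply, mul_comm] using h

/-- Multiplying the coordinate `q` by a `2 n`-th root of unity changes the sign of this
moment. -/
theorem haarMean_unitCoord_eq_zero {d : ℕ} [NeZero d] {p q : Fin d} (hpq : p ≠ q) (s k : ℕ)
    {n : ℕ} (hn : n ≠ 0) :
    haarMean (UnitGroup d)
      (unitCoord p ^ s * (star unitCoord p ^ k * star unitCoord q ^ n)) = 0 := by
  set ζ : ℂ := Complex.exp (Real.pi / n * Complex.I) with hζ
  have hn' : (n : ℂ) ≠ 0 := by exact_mod_cast hn
  have hζn : ζ ^ n = -1 := by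
    rw [hζ, ← Complex.exp_nat_mul, ← Complex.exp_pi_mul_I]
    congr 1
    field_simp
  have hζ1 : star ζ * ζ = 1 := by
    have : ‖ζ‖ = 1 := by
      rw [hζ]; exact_mod_cast Complex.norm_exp_ofReal_mul_I (Real.pi / n)
    rw [Complex.star_def, Complex.conj_mul', this]
    simp
  have hD : Matrix.diagonal (fun a => if a = q then ζ else 1) ∈ UnitGroup d := by
    rw [Matrix.mem_unitaryGroup_iff', Matrix.star_eq_conjTranspose, Matrix.diagonal_conjTranspose,
      Matrix.diagonal_mul_diagonal, ← Matrix.diagonal_one]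
    congr 1
    ext a
    by_cases ha : a = q
    · simpa [ha] using hζ1
    · simp [ha]
  have hφ : ∀ a : Fin d, leftTranslate (⟨_, hD⟩ : UnitGroup d) (unitCoord a) =
      (if a = q then ζ else 1) • unitCoord a := by
    intro a
    ext U
    rw [leftTranslate_apply, unitCoord_mul]
    by_cases ha : a = q <;> simp [Matrix.diagonal_apply, ha]
  have hφ' : ∀ a : Fin d, leftTranslate (⟨_, hD⟩ : UnitGroup d) (star unitCoord a) =
      star (if a = q then ζ else 1) • star unitCoord a := by
    intro a
    ext U
    have := congrArg (fun f : C(UnitGroup d, ℂ) => star (f U)) (hφ a)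
    by_cases ha : a = q <;> simpa [leftTranslate_apply, ha] using this
  have h := haarMean_leftTranslate (⟨_, hD⟩ : UnitGroup d)
    (unitCoord p ^ s * (star unitCoord p ^ k * star unitCoord q ^ n))
  have hs : star ζ ^ n = -1 := by rw [← star_pow, hζn]; simp
  simp only [map_mul (leftTranslate _), map_pow (leftTranslate _), hφ, hφ', if_neg hpq, if_true,
    star_one, one_smul, smul_pow, hs] at h
  rw [mul_smul_comm, mul_smul_comm, map_smul, smul_eq_mul] at h
  linear_combination (-1 / 2) * h

/-- The Haar random state has the moment operator `rhoSym`: in the two-point reduction all the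
mixed moments vanish by phase invariance. -/
theorem unitTwirl_eq_rhoSym (d : ℕ) [NeZero d] (t : ℕ) :
    unitTwirl t (EuclideanSpace.single (0 : Fin d) (1 : ℂ)) = rhoSym d t := by
  ext i j
  have hU := isOrthInvariant_unitCoord (d := d)
  rw [← moment_eq_rhoSym (haarMean (UnitGroup d)) unitCoord (star unitCoord) t
    (haarMean (UnitGroup d) (unitCoord 0 ^ t * star unitCoord 0 ^ t)) haarMean_one
    sum_unitCoord_mul_star (hU.moment_linForm_linForm (fun p => hU.moment_eq 0 p t t)
      fun p q hpq k hk => haarMean_unitCoord_eq_zero hpq t k (Nat.sub_pos_of_lt hk).ne'),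
    haarMean_apply, unitTwirl, Matrix.of_apply]
  congr 1
  ext U
  simp only [tensorPow, Matrix.of_apply, mul_ketBra_mul_apply, Finset.prod_mul_distrib,
    ContinuousMap.mul_apply, ContinuousMap.prod_apply, Pi.star_apply, ContinuousMap.star_apply,
    unitCoord_apply]
  simp [Matrix.vecMul, Matrix.mulVec, dotProduct, Pi.single_apply, apply_ite]

theorem isStateDesign_orbitLaw_iff {d : ℕ} [NeZero d] {ψ : EuclideanSpace ℂ (Fin d)}
    (hψ : ‖ψ‖ = 1) (t : ℕ) :
    IsStateDesign t (orbitLaw ψ) ↔ orthTwirl t ψ = rhoSym d t := by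
  rw [IsStateDesign, momentOp_orbitLaw, unitTwirl_eq_rhoSym]
  exact ⟨fun h => h.2.2, fun h =>
    ⟨isProbabilityMeasure_orbitLaw ψ, norm_eq_one_of_orbitLaw hψ, h⟩⟩

/-! ### The overlap condition -/

/-- For `overlap ψ ^ 2 = 2 / (d + 1)` the mixed moments in the two-point reduction vanish: the odd
ones by symmetry, the even one by `IsOrthInvariant.mixed_moment_eq_zero`. -/
theorem orthTwirl_three_eq_rhoSym {d : ℕ} [NeZero d] {ψ : EuclideanSpace ℂ (Fin d)}
    (hψ : ‖ψ‖ = 1) (ho : overlap ψ ^ 2 = 2 / ((d : ℝ) + 1)) :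
    orthTwirl 3 ψ = rhoSym d 3 := by
  have hO := isOrthInvariant_orthCoord ψ
  have hστ := sum_sq_mul_star ψ
  rw [ho] at hστ
  push_cast at hστ
  ext i j
  rw [orthTwirl_apply, moment_eq_rhoSym (haarMean (OrthGroup d)) (orthCoord ψ)
    (star (orthCoord ψ)) 3 _ haarMean_one (sum_orthCoord_mul_star hψ)
    (hO.moment_linForm_linForm (fun p => hO.moment_eq 0 p 3 3) fun p q hpq k hk => ?_)]
  -- the moments that are odd in the coordinate `q` vanish under a reflection
  have hodd : ∀ k n, Odd n → haarMean (OrthGroup d)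
      (orthCoord ψ p ^ 3 * (star (orthCoord ψ) p ^ k * star (orthCoord ψ) q ^ n)) = 0 := by
    intro k n hn
    obtain ⟨φ, h1, h2, h3, -, h5⟩ := hO.exists_pair hpq (v := Pi.single p 1)
      (w := (-1 : ℝ) • Pi.single q 1) (by simp) (by simp) (by simp [hpq])
    have h := h1 (orthCoord ψ p ^ 3 * (star (orthCoord ψ) p ^ k * star (orthCoord ψ) q ^ n))
    simp only [map_mul φ, map_pow φ, h2, h3, h5, linForm_smul, linForm_single, smul_pow] at h
    rw [mul_smul_comm, mul_smul_comm, map_smul, smul_eq_mul] at h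
    push_cast at h
    rw [hn.neg_one_pow] at h
    linear_combination (-1 / 2) * h
  interval_cases k
  · exact hodd 0 3 (by decide)
  · simpa using hO.mixed_moment_eq_zero haarMean_one (sum_orthCoord_mul_star hψ)
      (sum_orthCoord_sq ψ) (sum_star_orthCoord_sq ψ) hστ hpq
  · exact hodd 2 1 (by decide)

/-- Two evaluations of the moment of `Z_0 ^ 2` against `∑ q, conj Z_q ^ 2`, a constant. -/
theorem overlap_sq_of_orthTwirl_two {d : ℕ} [NeZero d] {ψ : EuclideanSpace ℂ (Fin d)}
    (h : orthTwirl 2 ψ = rhoSym d 2) : overlap ψ ^ 2 = 2 / ((d : ℝ) + 1) := by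
  have hO := isOrthInvariant_orthCoord ψ
  have h1 : star (∑ a, ψ a ^ 2) * haarMean (OrthGroup d) (orthCoord ψ 0 ^ 2) =
      ∑ q, rhoSym d 2 (fun _ => 0) (fun _ => q) := by
    simp only [← h, orthTwirl_apply, Finset.prod_const, Finset.card_univ, Fintype.card_fin]
    rw [← map_sum, ← Finset.mul_sum, sum_star_orthCoord_sq, mul_smul_comm, map_smul, mul_one,
      smul_eq_mul]
  have h2 : ∑ q, rhoSym d 2 (fun _ => 0) (fun _ => q) = 2 / ((d : ℂ) * (d + 1)) := by
    simp [rhoSym_apply, permCount_const, Finset.prod_range_succ]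
    field_simp
  have h3 := hO.moment_two_zero haarMean_one (sum_orthCoord_sq ψ) 0
  have h4 := sum_sq_mul_star ψ
  have hd : (d : ℂ) ≠ 0 := by exact_mod_cast NeZero.ne d
  have hd1 : (d : ℂ) + 1 ≠ 0 := by exact_mod_cast Nat.succ_ne_zero d
  have : ((overlap ψ ^ 2 : ℝ) : ℂ) = ((2 / ((d : ℝ) + 1) : ℝ) : ℂ) := by
    rw [← h4, ← h3, mul_assoc, mul_comm (haarMean _ _), h3, h1, h2]
    push_cast
    field_simp
  exact_mod_cast this

/-- Two evaluations of the moment of `Z_0 ^ 4` against `(∑ q, conj Z_q ^ 2) ^ 2`, a constant. Only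
the term `Z_0 ^ 4 * conj Z_0 ^ 4` of the expanded square contributes to the moments of
`rhoSym`. -/
theorem overlap_pow_four_of_orthTwirl_four {d : ℕ} [NeZero d] {ψ : EuclideanSpace ℂ (Fin d)}
    (h : orthTwirl 4 ψ = rhoSym d 4) :
    overlap ψ ^ 4 = 8 / (((d : ℝ) + 1) * ((d : ℝ) + 3)) := by
  have hO := isOrthInvariant_orthCoord ψ
  have h1 : star (∑ a, ψ a ^ 2) ^ 2 * haarMean (OrthGroup d) (orthCoord ψ 0 ^ 4) =
      ∑ q, ∑ r, rhoSym d 4 (fun _ => 0) ![q, q, r, r] := by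
    have hqr : ∀ q r, rhoSym d 4 (fun _ => 0) ![q, q, r, r] = haarMean (OrthGroup d)
        (orthCoord ψ 0 ^ 4 * (star (orthCoord ψ) q ^ 2 * star (orthCoord ψ) r ^ 2)) := by
      intro q r
      rw [← h, orthTwirl_apply]
      simp only [Finset.prod_const, Finset.card_univ, Fintype.card_fin, Fin.prod_univ_four]
      congr 2
      simp [sq, mul_assoc]
    simp only [hqr, ← map_sum, ← Finset.mul_sum]
    rw [← Finset.sum_mul, sum_star_orthCoord_sq, smul_mul_smul_comm, mul_smul_comm, map_smul,
      mul_one, mul_one, smul_eq_mul, sq]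
  have h2 : ∑ q, ∑ r, rhoSym d 4 (fun _ => 0) ![q, q, r, r] =
      24 / ((d : ℂ) * (d + 1) * (d + 2) * (d + 3)) := by
    have hqr : ∀ q r : Fin d, permCount (fun _ => 0) ![q, q, r, r] =
        if q = 0 then if r = 0 then 24 else 0 else 0 := by
      intro q r
      rw [permCount_const]
      by_cases hq : q = 0 <;> by_cases hr : r = 0 <;> simp [Fin.forall_fin_succ, hq, hr,
        Nat.factorial]
    simp [rhoSym_apply, hqr, Finset.prod_range_succ]
    field_simp
  have h3 := hO.moment_four_zero haarMean_one (sum_orthCoord_sq ψ) 0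
  have h4 := sum_sq_mul_star ψ
  have hd : (d : ℂ) ≠ 0 := by exact_mod_cast NeZero.ne d
  have hd1 : (d : ℂ) + 1 ≠ 0 := by exact_mod_cast Nat.succ_ne_zero d
  have hd2 : (d : ℂ) + 2 ≠ 0 := by exact_mod_cast Nat.succ_ne_zero (d + 1)
  have hd3 : (d : ℂ) + 3 ≠ 0 := by exact_mod_cast Nat.succ_ne_zero (d + 2)
  rw [h2, eq_div_iff (by simp [hd, hd1, hd2, hd3])] at h1
  have : ((overlap ψ ^ 4 : ℝ) : ℂ) = ((8 / (((d : ℝ) + 1) * ((d : ℝ) + 3)) : ℝ) : ℂ) := by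
    rw [show overlap ψ ^ 4 = (overlap ψ ^ 2) ^ 2 by ring, Complex.ofReal_pow, ← h4]
    push_cast
    rw [eq_div_iff (by simp [hd1, hd3])]
    linear_combination (1 / 3) * h1 -
      (1 / 3) * (d + 1) * (d + 3) * star (∑ a, ψ a ^ 2) ^ 2 * h3
  exact_mod_cast this

theorem four_design_constraints_incompatible {d : ℕ} (hd : 1 < d) :
    ¬ ∃ x : ℝ, x ^ 2 = 2 / ((d : ℝ) + 1) ∧ x ^ 4 = 8 / (((d : ℝ) + 1) * ((d : ℝ) + 3)) := by
  rintro ⟨x, h2, h4⟩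
  have hd' : (1 : ℝ) < d := by exact_mod_cast hd
  have hd1 : (d : ℝ) + 1 ≠ 0 := by positivity
  have hd3 : (d : ℝ) + 3 ≠ 0 := by positivity
  rw [show x ^ 4 = (x ^ 2) ^ 2 by ring, h2] at h4
  field_simp at h4
  linarith

/-- The state `√((1 + s) / 2) |0⟩ + i √((1 - s) / 2) |1⟩` has overlap `s`. -/
theorem exists_overlap_sq (d : ℕ) [NeZero d] :
    ∃ ψ : EuclideanSpace ℂ (Fin d), ‖ψ‖ = 1 ∧ overlap ψ ^ 2 = 2 / ((d : ℝ) + 1) := by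
  obtain _ | _ | n := d
  · exact absurd rfl (NeZero.ne 0)
  · refine ⟨EuclideanSpace.single 0 1, by simp, ?_⟩
    rw [overlap_eq]
    norm_num
  · set s : ℝ := Real.sqrt (2 / (((n + 2 : ℕ) : ℝ) + 1)) with hs
    have hs0 : 0 ≤ s := Real.sqrt_nonneg _
    have hs2 : s ^ 2 = 2 / (((n + 2 : ℕ) : ℝ) + 1) := Real.sq_sqrt (by positivity)
    have hs1 : s ≤ 1 := by
      rw [hs, Real.sqrt_le_one, div_le_one (by positivity)]
      push_cast
      have : (0 : ℝ) ≤ n := n.cast_nonneg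
      linarith
    have ha := Real.sq_sqrt (show 0 ≤ (1 + s) / 2 by linarith)
    have hb := Real.sq_sqrt (show 0 ≤ (1 - s) / 2 by linarith)
    set a := Real.sqrt ((1 + s) / 2)
    set b := Real.sqrt ((1 - s) / 2)
    refine ⟨WithLp.toLp 2 (Fin.cons (a : ℂ) (Fin.cons (Complex.I * b) 0)), ?_, ?_⟩
    · rw [EuclideanSpace.norm_eq, Real.sqrt_eq_one]
      simp only [Fin.sum_univ_succ, Fin.cons_zero, Fin.cons_succ]
      simp [ha, hb]
      ring
    · rw [overlap_eq]
      simp only [Fin.sum_univ_succ, Fin.cons_zero, Fin.cons_succ]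
      have : (a : ℂ) ^ 2 + ((Complex.I * b) ^ 2 + 0) = (s : ℂ) := by
        rw [mul_pow, Complex.I_sq, ← Complex.ofReal_pow, ← Complex.ofReal_pow, ha, hb]
        push_cast
        ring
      simp only [Pi.zero_apply, ne_eq, OfNat.ofNat_ne_zero, not_false_eq_true, zero_pow,
        Finset.sum_const_zero]
      rw [this, Complex.norm_real, Real.norm_of_nonneg hs0, hs2]

end OrthDesign

theorem theorem2 (d : ℕ) [NeZero d] :
    -- states satisfying the condition exist
    (∃ ψ : EuclideanSpace ℂ (Fin d), ‖ψ‖ = 1 ∧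
      OrthDesign.overlap ψ ^ 2 = 2 / ((d : ℝ) + 1)) ∧
    -- and the orbit of every such state is an exact state 3-design
    (∀ ψ : EuclideanSpace ℂ (Fin d), ‖ψ‖ = 1 →
      OrthDesign.overlap ψ ^ 2 = 2 / ((d : ℝ) + 1) →
        OrthDesign.orthTwirl 3 ψ = OrthDesign.rhoSym d 3 ∧
        OrthDesign.IsStateDesign 3 (OrthDesign.orbitLaw ψ)) ∧
    -- no orbit is an exact state t-design for t > 3 and d > 1
    (1 < d → ∀ t : ℕ, 3 < t → ∀ ψ : EuclideanSpace ℂ (Fin d), ‖ψ‖ = 1 →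
        OrthDesign.orthTwirl t ψ ≠ OrthDesign.rhoSym d t ∧
        ¬ OrthDesign.IsStateDesign t (OrthDesign.orbitLaw ψ)) ∧
    -- the constraints at t = 4
    (∀ ψ : EuclideanSpace ℂ (Fin d), ‖ψ‖ = 1 →
      OrthDesign.orthTwirl 4 ψ = OrthDesign.rhoSym d 4 →
        OrthDesign.overlap ψ ^ 2 = 2 / ((d : ℝ) + 1) ∧
        OrthDesign.overlap ψ ^ 4 = 8 / (((d : ℝ) + 1) * ((d : ℝ) + 3))) ∧
    -- which are incompatible for d > 1
    (1 < d → ¬ ∃ x : ℝ, x ^ 2 = 2 / ((d : ℝ) + 1) ∧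
      x ^ 4 = 8 / (((d : ℝ) + 1) * ((d : ℝ) + 3))) := by
  have hfour : ∀ ψ : EuclideanSpace ℂ (Fin d), ‖ψ‖ = 1 →
      OrthDesign.orthTwirl 4 ψ = OrthDesign.rhoSym d 4 →
        OrthDesign.overlap ψ ^ 2 = 2 / ((d : ℝ) + 1) ∧
        OrthDesign.overlap ψ ^ 4 = 8 / (((d : ℝ) + 1) * ((d : ℝ) + 3)) := fun ψ hψ h =>
    ⟨OrthDesign.overlap_sq_of_orthTwirl_two
      (OrthDesign.orthTwirl_eq_rhoSym_of_le hψ (by norm_num) h),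
      OrthDesign.overlap_pow_four_of_orthTwirl_four h⟩
  refine ⟨OrthDesign.exists_overlap_sq d, fun ψ hψ ho => ?_, fun hd t ht ψ hψ => ?_, hfour,
    OrthDesign.four_design_constraints_incompatible⟩
  · have h := OrthDesign.orthTwirl_three_eq_rhoSym hψ ho
    exact ⟨h, (OrthDesign.isStateDesign_orbitLaw_iff hψ 3).mpr h⟩
  · have h : OrthDesign.orthTwirl t ψ ≠ OrthDesign.rhoSym d t := fun h =>
      OrthDesign.four_design_constraints_incompatible hd
        ⟨_, hfour ψ hψ (OrthDesign.orthTwirl_eq_rhoSym_of_le hψ ht h)⟩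
    exact ⟨h, fun hdes => h ((OrthDesign.isStateDesign_orbitLaw_iff hψ t).mp hdes)⟩
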